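/- **Setting.** Let $\hat H=\sum_{j=1}^m \hat H_j$ be a $K$-local Hamiltonian on $n$ qubits: each $\hat H_j$ is Hermitian, has operator norm $\|\hat H_j\|\le 1$ and is supported on at most $K$ qubits, and each qubit lies in the support of at most $K$ of the terms. For a state $\rho=\sum_i\lambda_i|\psi_i\rangle\langle\psi_i|$ (spectral decomposition) the quantum Fisher information for the evolution $e^{-i\theta \hat H/2}\rho\, e^{i\theta \hat H/2}$ is $$\mathcal F(\rho,\hat H)=\tfrac12\sum_{\lambda_i+\lambda_j\ne0}\frac{(\lambda_i-\lambda_j)^2}{\lambda_i+\lambda_j}\,|\langle\psi_i|\hat H|\psi_j\rangle|^2 .$$ A layer is a product of channels acting on disjoint blocks that cover $[n]$; a depth-$t$ circuit $\mathscr C=\mathcal C_t\circ\cdots\circ\mathcal C_1$ is a composition of $t$ layers. A connectivity constraint is a family $\mathcal G$ of allowed blocks. *All-to-all* $\kappa$-local circuits allow all blocks with at most $\kappa$ qubits. In an *$r$-dimensional* system the qubits sit at distinct sites of $\mathbb Z^r$, and a block is allowed if it lies inside some $\kappa\times\cdots\times\kappa$ hypercube of sites, where $\kappa\ge1$. The lightcone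 of a set $A$ through a layer is the union of $A$ and all blocks meeting $A$; the lightcone through a circuit is obtained by iterating over its layers. For a constraint $\mathcal G$, let $g_{\mathcal G}(t)$ be the maximum, over single qubits $q$, of the size of the union of the lightcones of $\{q\}$ through all depth-$t$ circuits allowed by $\mathcal G$. **Theorem.** Suppose that $\rho=\mathscr C(|0^n\rangle\langle 0^n|)$ for a depth-$t$ circuit $\mathscr C$. 1. If $\mathscr C$ obeys the constraint $\mathcal G$, then $\mathcal F(\rho,\hat H)\le mK^2\,g_{\mathcal G}(2t)$. 2. If $\mathscr C$ is $\kappa$-local with all-to-all connectivity, then $\mathcal F(\rho,\hat H)\le mK^2\,\kappa^{2t}$. 3. If $\mathscr C$ is $\kappa$-local in an $r$-dimensional system, then $\mathcal F(\rho,\hat H)\le mK^2\,(2(\kappa-1)\cdot 2t+1)^r$. Moreover, in such a system $g_{\mathcal G}(t)\le(2(\kappa-1)t+1)^r$ for every $t$, with equality if for some qubit every lattice site within sup-norm distance $(\kappa-1)t$ of it is occupied by a qubit. 4. Consequently, for all $K,\kappa,T$ and $c$ there is a constant $c'$ such that $\mathcal F(\rho,\hat H)\le c'n$ for all $n$, every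 $K$-local $\hat H$ on $n$ qubits with $m\le cn$ terms, and every $n$-qubit state $\rho$ prepared from $|0^n\rangle$ by an all-to-all $\kappa$-local circuit of depth at most $T$. 5. Hence beating this scaling requires long-range entanglement: let $(\rho_k)$ be a sequence of states on $n_k$ qubits and $(\hat H_k)$ $K$-local Hamiltonians on $n_k$ qubits with $m_k=O(n_k)$ terms, $K$ being fixed. If $\mathcal F(\rho_k,\hat H_k)$ is not $O(n_k)$, then $(\rho_k)$ is long-range entangled, i.e. there are no constants $\kappa,T$ such that every $\rho_k$ can be prepared from $|0^{n_k}\rangle$ by an all-to-all $\kappa$-local circuit of depth at most $T$. -/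

import Mathlib

noncomputable section

namespace ShallowQFI

open Matrix
open scoped ComplexOrder

/-! ### Qubit systems and supports -/

/-- Operators on the qubits indexed by `ι`, as matrices in the computational basis. -/
abbrev Op (ι : Type) [Fintype ι] : Type := Matrix (ι → Fin 2) (ι → Fin 2) ℂ

/-- The bit string that agrees with `a` on `B` and with `x` outside `B`. -/
def merge {n : ℕ} (B : Finset (Fin n)) (a : B → Fin 2) (x : Fin n → Fin 2) : Fin n → Fin 2 :=
  fun i => if h : i ∈ B then a ⟨i, h⟩ else x i

/-- The operator `O_A ⊗ 𝟙` on all `n` qubits, for an operator `O_A` on the qubits of `A`. -/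
def extendOp {n : ℕ} (A : Finset (Fin n)) (OA : Op A) : Op (Fin n) :=
  open Classical in
  Matrix.of fun x y =>
    if ∀ i, i ∉ A → x i = y i then OA (fun i => x i) (fun i => y i) else 0

/-- `O` has the form `O_A ⊗ 𝟙`, that is, it acts trivially outside `A`. -/
def ActsOn {n : ℕ} (A : Finset (Fin n)) (O : Op (Fin n)) : Prop :=
  ∃ OA : Op A, O = extendOp A OA

/-- The support of `O`: the intersection of all sets of qubits on which `O` acts. By
`actsOn_supp` below, it is the smallest set `A` such that `O = O_A ⊗ 𝟙`. -/
def supp {n : ℕ} (O : Op (Fin n)) : Finset (Fin n) :=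
  open Classical in
  Finset.univ.filter fun i => ∀ A : Finset (Fin n), ActsOn A O → i ∈ A

/-- Acting on `A`, in terms of matrix entries. -/
theorem actsOn_iff {n : ℕ} (A : Finset (Fin n)) (O : Op (Fin n)) :
    ActsOn A O ↔ (∀ x y, O x y ≠ 0 → ∀ i, i ∉ A → x i = y i) ∧
      ∀ x y x' y', (∀ i, i ∉ A → x i = y i) → (∀ i, i ∉ A → x' i = y' i) →
        (∀ i ∈ A, x i = x' i) → (∀ i ∈ A, y i = y' i) → O x y = O x' y' := by
  classical
  constructor
  · rintro ⟨OA, rfl⟩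
    refine ⟨fun x y h => ?_, fun x y x' y' h h' hx hy => ?_⟩
    · by_contra hc
      exact h (by simp only [extendOp, Matrix.of_apply]; rw [if_neg hc])
    · simp only [extendOp, Matrix.of_apply]
      rw [if_pos h, if_pos h']
      congr 1
      · funext i; exact hx i i.2
      · funext i; exact hy i i.2
  · rintro ⟨h1, h2⟩
    refine ⟨Matrix.of fun a b => O (merge A a 0) (merge A b 0), ?_⟩
    ext x y
    simp only [extendOp, Matrix.of_apply]
    split_ifs with h
    · apply h2 _ _ _ _ h
      · intro i hi; simp [merge, hi]
      · intro i hi; simp [merge, hi]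
      · intro i hi; simp [merge, hi]
    · by_contra hc
      exact h (h1 x y hc)

theorem actsOn_univ {n : ℕ} (O : Op (Fin n)) : ActsOn Finset.univ O := by
  rw [actsOn_iff]
  refine ⟨fun x y _ i hi => absurd (Finset.mem_univ i) hi, fun x y x' y' _ _ hx hy => ?_⟩
  rw [show x = x' from funext fun i => hx i (Finset.mem_univ i),
    show y = y' from funext fun i => hy i (Finset.mem_univ i)]

theorem ActsOn.inter {n : ℕ} {A B : Finset (Fin n)} {O : Op (Fin n)}
    (hA : ActsOn A O) (hB : ActsOn B O) : ActsOn (A ∩ B) O := by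
  classical
  rw [actsOn_iff] at hA hB ⊢
  refine ⟨fun x y h i hi => ?_, fun x y x' y' h h' hx hy => ?_⟩
  · by_cases hiA : i ∈ A
    · exact hB.1 x y h i fun hiB => hi (Finset.mem_inter.2 ⟨hiA, hiB⟩)
    · exact hA.1 x y h i hiA
  · -- change the bits outside `A` first, then the bits of `A` outside `B`
    have key : ∀ z z' : Fin n → Fin 2, (∀ i, i ∉ A ∩ B → z i = z' i) →
        O z z' = O (fun i => if i ∈ A then z i else 0) (fun i => if i ∈ A then z' i else 0) := by
      intro z z' hz
      apply hA.2
      · intro i hi; exact hz i fun hc => hi (Finset.mem_inter.1 hc).1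
      · intro i hi; simp [hi]
      · intro i hi; simp [hi]
      · intro i hi; simp [hi]
    rw [key x y h, key x' y' h']
    apply hB.2
    · intro i hi
      have := h i fun hc => hi (Finset.mem_inter.1 hc).2
      simp [this]
    · intro i hi
      have := h' i fun hc => hi (Finset.mem_inter.1 hc).2
      simp [this]
    · intro i hi
      by_cases hiA : i ∈ A
      · simpa [hiA] using hx i (Finset.mem_inter.2 ⟨hiA, hi⟩)
      · simp [hiA]
    · intro i hi
      by_cases hiA : i ∈ A
      · simpa [hiA] using hy i (Finset.mem_inter.2 ⟨hiA, hi⟩)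
      · simp [hiA]

/-- An operator acts on its support. -/
theorem actsOn_supp {n : ℕ} (O : Op (Fin n)) : ActsOn (supp O) O := by
  classical
  have h : ∀ S : Finset (Finset (Fin n)), (∀ A ∈ S, ActsOn A O) → ActsOn (S.inf id) O := by
    intro S
    induction S using Finset.induction_on with
    | empty => intro _; simpa using actsOn_univ O
    | insert A S _ ih =>
      intro hS
      rw [Finset.inf_insert]
      exact (hS A (Finset.mem_insert_self A S)).inter
        (ih fun B hB => hS B (Finset.mem_insert_of_mem hB))
  have h2 := h (Finset.univ.filter fun A => ActsOn A O) (by simp)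
  convert h2 using 1
  ext i
  simp [supp, Finset.mem_inf]

/-- A `K`-local Hamiltonian with `m` terms on `n` qubits: every term is Hermitian, acts on at
most `K` qubits and has operator norm at most `1`, and every qubit lies in the support of at
most `K` terms (counted with multiplicity, that is, by their index). -/
structure LocalHamiltonian (n m K : ℕ) where
  /-- the local terms -/
  term : Fin m → Op (Fin n)
  isHermitian : ∀ j, (term j).IsHermitian
  card_supp_le : ∀ j, (supp (term j)).card ≤ K
  degree_le : ∀ i : Fin n, (Finset.univ.filter fun j => i ∈ supp (term j)).card ≤ K
  norm_le_one : ∀ j, ‖Matrix.toEuclideanCLM (n := Fin n → Fin 2) (𝕜 := ℂ) (term j)‖ ≤ 1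

/-- The Hamiltonian itself, the sum of its terms. -/
def LocalHamiltonian.total {n m K : ℕ} (H : LocalHamiltonian n m K) : Op (Fin n) :=
  ∑ j, H.term j

/-! ### States and quantum Fisher information -/

/-- `n`-qubit states: density matrices. -/
structure QState (n : ℕ) where
  /-- the density matrix -/
  mat : Op (Fin n)
  posSemidef : mat.PosSemidef
  trace_eq_one : mat.trace = 1

/-- The quantum Fisher information of `ρ = ∑ᵢ λᵢ |ψᵢ⟩⟨ψᵢ|` with respect to the evolution
`ρ(θ) = exp(-iθH/2) ρ exp(iθH/2)`:
`½ ∑_{λᵢ + λⱼ ≠ 0} (λᵢ - λⱼ)² / (λᵢ + λⱼ) |⟨ψᵢ|H|ψⱼ⟩|²`. -/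
def qfi {n : ℕ} (ρ : QState n) (H : Op (Fin n)) : ℝ :=
  let ev := ρ.posSemidef.isHermitian.eigenvalues
  let ψ := ρ.posSemidef.isHermitian.eigenvectorBasis
  (1 / 2) * ∑ i, ∑ j,
    if ev i + ev j ≠ 0 then
      (ev i - ev j) ^ 2 / (ev i + ev j) *
        ‖inner ℂ (ψ i) (Matrix.toEuclideanCLM (n := Fin n → Fin 2) (𝕜 := ℂ) H (ψ j))‖ ^ 2
    else 0

/-! ### Channels, layers and circuits -/

/-- The map `Φ ⊗ id` on operators over the product of `d` with a `k`-dimensional ancilla. -/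
def amplify {d : Type} (Φ : Matrix d d ℂ →ₗ[ℂ] Matrix d d ℂ) (k : ℕ)
    (X : Matrix (d × Fin k) (d × Fin k) ℂ) : Matrix (d × Fin k) (d × Fin k) ℂ :=
  Matrix.of fun p q => Φ (Matrix.of fun a b => X (a, p.2) (b, q.2)) p.1 q.1

/-- Quantum channels from a system with basis `d` to itself: completely positive,
trace-preserving linear maps. -/
structure Channel (d : Type) [Fintype d] where
  /-- the underlying linear map -/
  toLin : Matrix d d ℂ →ₗ[ℂ] Matrix d d ℂ
  completelyPositive : ∀ (k : ℕ) (X : Matrix (d × Fin k) (d × Fin k) ℂ),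
    X.PosSemidef → (amplify toLin k X).PosSemidef
  tracePreserving : ∀ X, (toLin X).trace = X.trace

/-- A gate: a channel on the qubits of a set `block`. -/
structure Gate (n : ℕ) where
  /-- the qubits on which the gate acts -/
  block : Finset (Fin n)
  /-- the channel on these qubits -/
  chan : Channel (block → Fin 2)

/-- The action of a gate on all `n` qubits: its channel on `block`, tensored with the identity
channel on the other qubits. -/
def Gate.apply {n : ℕ} (G : Gate n) (X : Op (Fin n)) : Op (Fin n) :=
  Matrix.of fun x y =>
    G.chan.toLin (Matrix.of fun a b => X (merge G.block a x) (merge G.block b y))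
      (fun i => x i) (fun i => y i)

/-- A layer: gates on pairwise disjoint blocks that together cover all qubits. (A qubit on which
nothing happens carries the identity channel.) -/
structure Layer (n : ℕ) where
  /-- the gates of the layer; as their blocks are disjoint, their order does not matter -/
  gates : List (Gate n)
  pairwise_disjoint : gates.Pairwise fun G G' => Disjoint G.block G'.block
  cover : ∀ i : Fin n, ∃ G ∈ gates, i ∈ G.block

/-- The action of a layer: the product of its gates. -/
def Layer.apply {n : ℕ} (L : Layer n) (X : Op (Fin n)) : Op (Fin n) :=
  L.gates.foldl (fun Y G => G.apply Y) X

/-- Circuits `[C₁, …, C_t]`, where `C₁` is applied first; the depth is the length `t`. -/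
abbrev Circuit (n : ℕ) : Type := List (Layer n)

/-- The action `C_t ∘ ⋯ ∘ C₁` of a circuit. -/
def Circuit.apply {n : ℕ} (C : Circuit n) (X : Op (Fin n)) : Op (Fin n) :=
  List.foldl (fun Y L => Layer.apply L Y) X C

/-- The depth of a circuit. -/
def Circuit.depth {n : ℕ} (C : Circuit n) : ℕ := List.length C

/-- The initial state `|0ⁿ⟩⟨0ⁿ|`. -/
def zeroState (n : ℕ) : Op (Fin n) := Matrix.single 0 0 1

/-- The circuit prepares the state `ρ` from `|0ⁿ⟩`. -/
def Circuit.Prepares {n : ℕ} (C : Circuit n) (ρ : QState n) : Prop :=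
  C.apply (zeroState n) = ρ.mat

/-! ### Connectivity and growth of lightcones -/

/-- A connectivity constraint: the set of blocks on which a gate may act. -/
abbrev Connectivity (n : ℕ) : Type := Set (Finset (Fin n))

/-- All gates of the circuit act on blocks that the constraint allows. -/
def Circuit.Obeys {n : ℕ} (C : Circuit n) (𝒢 : Connectivity n) : Prop :=
  ∀ L ∈ C, ∀ G ∈ L.gates, G.block ∈ 𝒢

/-- `κ`-local gates with all-to-all connectivity: any set of at most `κ` qubits. -/
def allToAll (n κ : ℕ) : Connectivity n := {B | B.card ≤ κ}

/-- Gates in `r` dimensions, for qubits located at the sites `pos q` of the lattice `ℤ^r`: every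
gate acts inside some `κ × ⋯ × κ` hypercube of sites. -/
def lattice {n r : ℕ} (pos : Fin n → Fin r → ℤ) (κ : ℕ) : Connectivity n :=
  {B | ∃ c : Fin r → ℤ, ∀ q ∈ B, ∀ i, c i ≤ pos q i ∧ pos q i < c i + κ}

/-- The lightcone of `A` through one layer: `A`, with all blocks that meet `A`. -/
def Layer.lightcone {n : ℕ} (L : Layer n) (A : Finset (Fin n)) : Finset (Fin n) :=
  open Classical in
  A ∪ Finset.univ.filter fun i => ∃ G ∈ L.gates, (G.block ∩ A).Nonempty ∧ i ∈ G.block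

/-- The lightcone of `A` through a circuit. -/
def Circuit.lightcone {n : ℕ} (C : Circuit n) (A : Finset (Fin n)) : Finset (Fin n) :=
  List.foldl (fun A' L => Layer.lightcone L A') A C

/-- The operator diffusion function: the union of the lightcones of `A` through all depth-`t`
circuits that the constraint allows. -/
def diffusion {n : ℕ} (𝒢 : Connectivity n) (t : ℕ) (A : Finset (Fin n)) : Finset (Fin n) :=
  open Classical in
  Finset.univ.filter fun i =>
    ∃ C : Circuit n, C.depth = t ∧ C.Obeys 𝒢 ∧ i ∈ C.lightcone A

/-- The lightcone growth function: the largest size of the diffusion of a single qubit. -/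
def growth {n : ℕ} (𝒢 : Connectivity n) (t : ℕ) : ℕ :=
  Finset.univ.sup fun q : Fin n => (diffusion 𝒢 t {q}).card

/-! ### Families of states -/

/-- The family of states can be prepared by shallow circuits: there are constants `κ` and `T`
such that each of its states is prepared from `|0ⁿ⟩` by a circuit of `κ`-local channels, with
all-to-all connectivity, of depth at most `T`. (As one-qubit channels prepare every product state
in depth one, starting from an arbitrary product state instead gives the same notion.) -/
def IsShallow {n : ℕ → ℕ} (ρ : ∀ k, QState (n k)) : Prop :=
  ∃ κ T : ℕ, ∀ k, ∃ C : Circuit (n k),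
    C.depth ≤ T ∧ C.Obeys (allToAll (n k) κ) ∧ C.Prepares (ρ k)

/-- The family of states is long-range entangled: no shallow circuits prepare it. -/
def IsLongRangeEntangled {n : ℕ → ℕ} (ρ : ∀ k, QState (n k)) : Prop :=
  ¬ IsShallow ρ

end ShallowQFI

end

open ShallowQFI Asymptotics Filter

/-!
Work in the Heisenberg picture. The dual of a gate is unital and is a bimodule map over the
operators that act off its block, so the dual of a layer, and hence of a circuit, spreads an
observable over at most its backward lightcone and is multiplicative on two observables whose
backward lightcones are disjoint. In a state prepared from the product state `|0ⁿ⟩` such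
observables are therefore uncorrelated. As `(λᵢ - λⱼ)² / (λᵢ + λⱼ) ≤ λᵢ + λⱼ`, the quantum Fisher
information is at most the variance `∑ⱼₖ cov(Hⱼ, Hₖ)` of the Hamiltonian; each covariance is at
most `1`, and it vanishes unless the support of `Hₖ` meets the lightcone of the support of `Hⱼ`
through the circuit run backwards and then forwards. This lightcone has depth `2t`, which leaves
at most `K · g(2t) · K` choices of `k` for every `j`.
-/

noncomputable section

namespace ShallowQFI

open Matrix
open scoped ComplexOrder Kronecker

/-! ### Bipartite operators and dual maps -/

section Bipartite

variable {d e R : Type*}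

/-- The map `Φ ⊗ id` on the operators of a bipartite system: `Φ` is applied to every block in the
decomposition along the second factor. (`amplify` is the case of an ancilla `Fin k`.) -/
def tensorId [Semiring R] (Φ : Matrix d d R →ₗ[R] Matrix d d R) (X : Matrix (d × e) (d × e) R) :
    Matrix (d × e) (d × e) R :=
  Matrix.of fun p q => Φ (X.submatrix (·, p.2) (·, q.2)) p.1 q.1

theorem submatrix_tensorId [Semiring R] (Φ : Matrix d d R →ₗ[R] Matrix d d R)
    (X : Matrix (d × e) (d × e) R) (u v : e) :
    (tensorId Φ X).submatrix (·, u) (·, v) = Φ (X.submatrix (·, u) (·, v)) :=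
  rfl

variable [CommSemiring R] (Φ : Matrix d d R →ₗ[R] Matrix d d R)

theorem tensorId_kronecker (A : Matrix d d R) (B : Matrix e e R) :
    tensorId Φ (A ⊗ₖ B) = Φ A ⊗ₖ B := by
  ext ⟨a, u⟩ ⟨c, v⟩
  have hblock : (A ⊗ₖ B).submatrix (·, u) (·, v) = B u v • A := by
    ext a c
    simp [mul_comm]
  change Φ ((A ⊗ₖ B).submatrix (·, u) (·, v)) a c = _
  rw [hblock, map_smul]
  simp [mul_comm]

variable [Fintype d] [Fintype e]

theorem trace_mul_eq_sum_submatrix (X Y : Matrix (d × e) (d × e) R) :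
    (X * Y).trace =
      ∑ u, ∑ v, (X.submatrix (·, u) (·, v) * Y.submatrix (·, v) (·, u)).trace := by
  simp only [Matrix.trace, Matrix.diag, Matrix.mul_apply, Fintype.sum_prod_type_right,
    submatrix_apply]
  exact Finset.sum_congr rfl fun u _ => Finset.sum_comm

theorem submatrix_mul_one_kronecker [DecidableEq d] (X : Matrix (d × e) (d × e) R)
    (B : Matrix e e R) (u v : e) :
    (X * (1 ⊗ₖ B : Matrix (d × e) (d × e) R)).submatrix (·, u) (·, v) =
      ∑ w, B w v • X.submatrix (·, u) (·, w) := by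
  ext a c
  simp [Matrix.mul_apply, Fintype.sum_prod_type_right, Matrix.sum_apply, Matrix.one_apply,
    mul_comm]

theorem submatrix_one_kronecker_mul [DecidableEq d] (B : Matrix e e R)
    (X : Matrix (d × e) (d × e) R) (u v : e) :
    ((1 ⊗ₖ B : Matrix (d × e) (d × e) R) * X).submatrix (·, u) (·, v) =
      ∑ w, B u w • X.submatrix (·, w) (·, v) := by
  ext a c
  simp [Matrix.mul_apply, Fintype.sum_prod_type_right, Matrix.sum_apply, Matrix.one_apply]

theorem tensorId_mul_one_kronecker [DecidableEq d] (X : Matrix (d × e) (d × e) R)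
    (B : Matrix e e R) : tensorId Φ (X * (1 ⊗ₖ B)) = tensorId Φ X * (1 ⊗ₖ B) := by
  ext ⟨a, u⟩ ⟨c, v⟩
  suffices h : (tensorId Φ (X * (1 ⊗ₖ B))).submatrix (·, u) (·, v) =
      (tensorId Φ X * (1 ⊗ₖ B)).submatrix (·, u) (·, v) from congrFun₂ h a c
  simp only [submatrix_tensorId, submatrix_mul_one_kronecker, map_sum, map_smul]

theorem tensorId_one_kronecker_mul [DecidableEq d] (B : Matrix e e R)
    (X : Matrix (d × e) (d × e) R) : tensorId Φ ((1 ⊗ₖ B) * X) = (1 ⊗ₖ B) * tensorId Φ X := by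
  ext ⟨a, u⟩ ⟨c, v⟩
  suffices h : (tensorId Φ ((1 ⊗ₖ B) * X)).submatrix (·, u) (·, v) =
      ((1 ⊗ₖ B) * tensorId Φ X).submatrix (·, u) (·, v) from congrFun₂ h a c
  simp only [submatrix_tensorId, submatrix_one_kronecker_mul, map_sum, map_smul]

theorem exists_eq_kronecker_one_of_commute [DecidableEq d] [DecidableEq e]
    {Z : Matrix (d × e) (d × e) R} (h : ∀ B : Matrix e e R, Commute Z (1 ⊗ₖ B)) :
    ∃ A : Matrix d d R, Z = A ⊗ₖ 1 := by
  cases isEmpty_or_nonempty e with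
  | inl _ => exact ⟨0, Matrix.ext fun p => isEmptyElim p.2⟩
  | inr hne =>
    obtain ⟨w⟩ := hne
    refine ⟨Z.submatrix (·, w) (·, w), ?_⟩
    ext ⟨a, u⟩ ⟨c, v⟩
    have hblock : (Z * (1 ⊗ₖ Matrix.single v w 1)).submatrix (·, u) (·, w) =
        ((1 ⊗ₖ Matrix.single v w 1) * Z).submatrix (·, u) (·, w) := by rw [(h _).eq]
    rw [submatrix_mul_one_kronecker, submatrix_one_kronecker_mul] at hblock
    have hentry := congrFun₂ hblock a c
    simp only [Matrix.sum_apply, Matrix.smul_apply, submatrix_apply, smul_eq_mul] at hentry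
    simpa [Matrix.single_apply, Matrix.one_apply, ite_and, eq_comm] using hentry.symm

variable [DecidableEq d]

/-- The dual of a linear map on operators with respect to the trace pairing `(X, A) ↦ tr (X A)`:
it describes the map in the Heisenberg picture. -/
def traceDual : Matrix d d R →ₗ[R] Matrix d d R where
  toFun A := Matrix.of fun y x => (Φ (Matrix.single x y 1) * A).trace
  map_add' A B := by ext; simp [Matrix.mul_add]
  map_smul' r A := by ext; simp

theorem trace_map_mul (X A : Matrix d d R) : (Φ X * A).trace = (X * traceDual Φ A).trace := by
  have h : Matrix.traceLinearMap d R R ∘ₗ LinearMap.mulRight R A ∘ₗ Φ =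
      Matrix.traceLinearMap d R R ∘ₗ LinearMap.mulRight R (traceDual Φ A) :=
    Matrix.ext_linearMap _ fun x y => LinearMap.ext_ring <| by
      simp [Matrix.trace_single_mul, traceDual]
  exact congrArg (· X) h

theorem traceDual_one (hΦ : ∀ X, (Φ X).trace = X.trace) : traceDual Φ 1 = 1 := by
  refine Matrix.ext_iff_trace_mul_left.2 fun X => ?_
  rw [← trace_map_mul, mul_one, mul_one, hΦ]

theorem trace_tensorId_mul (X A : Matrix (d × e) (d × e) R) :
    (tensorId Φ X * A).trace = (X * tensorId (traceDual Φ) A).trace := by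
  simp only [trace_mul_eq_sum_submatrix, submatrix_tensorId, trace_map_mul]

end Bipartite

/-! ### Locality of operators -/

section Locality

variable {n : ℕ} {S T : Finset (Fin n)} {A B : Op (Fin n)}

/-- A bit string on all qubits, as the pair of its restrictions to `b` and to the complement. -/
def splitBits (b : Finset (Fin n)) :
    (Fin n → Fin 2) ≃ (b → Fin 2) × (↥bᶜ → Fin 2) where
  toFun x := (fun i => x i, fun i => x i)
  invFun p i := if h : i ∈ b then p.1 ⟨i, h⟩ else p.2 ⟨i, Finset.mem_compl.2 h⟩
  left_inv x := by ext i; simp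
  right_inv p := by
    ext i
    · simp
    · simp [Finset.mem_compl.1 i.2]

/-- The identification of the operators on all qubits with the operators on the bipartite system
formed by `b` and its complement. -/
def splitOp (b : Finset (Fin n)) :
    Op (Fin n) ≃ₐ[ℂ] Matrix ((b → Fin 2) × (↥bᶜ → Fin 2)) ((b → Fin 2) × (↥bᶜ → Fin 2)) ℂ :=
  Matrix.reindexAlgEquiv ℂ ℂ (splitBits b)

theorem splitOp_splitBits (b : Finset (Fin n)) (O : Op (Fin n)) (x y : Fin n → Fin 2) :
    splitOp b O (splitBits b x) (splitBits b y) = O x y := by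
  simp [splitOp]

theorem trace_splitOp (b : Finset (Fin n)) (O : Op (Fin n)) : (splitOp b O).trace = O.trace :=
  (splitBits b).symm.sum_comp fun x => O x x

theorem splitOp_extendOp (b : Finset (Fin n)) (O : Op b) : splitOp b (extendOp b O) = O ⊗ₖ 1 := by
  ext p q
  obtain ⟨x, rfl⟩ := (splitBits b).surjective p
  obtain ⟨y, rfl⟩ := (splitBits b).surjective q
  rw [splitOp_splitBits]
  simp [extendOp, splitBits, Matrix.one_apply, funext_iff]

theorem splitOp_extendOp_compl (b : Finset (Fin n)) (O : Op ↥bᶜ) :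
    splitOp b (extendOp bᶜ O) = 1 ⊗ₖ O := by
  ext p q
  obtain ⟨x, rfl⟩ := (splitBits b).surjective p
  obtain ⟨y, rfl⟩ := (splitBits b).surjective q
  rw [splitOp_splitBits]
  simp [extendOp, splitBits, Matrix.one_apply, funext_iff]

theorem actsOn_iff_splitOp : ActsOn S A ↔ ∃ A' : Op S, splitOp S A = A' ⊗ₖ 1 := by
  simp only [ActsOn, ← splitOp_extendOp, (splitOp S).injective.eq_iff]

theorem actsOn_compl_iff_splitOp : ActsOn Sᶜ B ↔ ∃ B' : Op ↥Sᶜ, splitOp S B = 1 ⊗ₖ B' := by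
  simp only [ActsOn, ← splitOp_extendOp_compl, (splitOp S).injective.eq_iff]

theorem ActsOn.mono (hA : ActsOn S A) (hST : S ⊆ T) : ActsOn T A := by
  classical
  obtain ⟨A, rfl⟩ := hA
  refine ⟨Matrix.of fun x y => if ∀ i : T, ↑i ∉ S → x i = y i then
    A (fun i => x ⟨i, hST i.2⟩) (fun i => y ⟨i, hST i.2⟩) else 0, ?_⟩
  ext x y
  have hagree : (∀ i, i ∉ S → x i = y i) ↔
      (∀ i, i ∉ T → x i = y i) ∧ ∀ i : T, ↑i ∉ S → x i = y i :=
    ⟨fun h => ⟨fun i hi => h i fun hS => hi (hST hS), fun i => h i⟩,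
      fun h i hi => if hT : i ∈ T then h.2 ⟨i, hT⟩ hi else h.1 i hT⟩
  simp only [extendOp, Matrix.of_apply, hagree, ite_and]

theorem ActsOn.compl_of_disjoint (hB : ActsOn T B) (h : Disjoint S T) : ActsOn Sᶜ B :=
  hB.mono (Finset.subset_compl_iff_disjoint_left.2 h)

theorem ActsOn.commute (hA : ActsOn S A) (hB : ActsOn T B) (h : Disjoint S T) : Commute A B := by
  obtain ⟨A', hA'⟩ := actsOn_iff_splitOp.1 hA
  obtain ⟨B', hB'⟩ := actsOn_compl_iff_splitOp.1 (hB.compl_of_disjoint h)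
  refine (splitOp S).injective ?_
  simp only [map_mul, hA', hB', ← mul_kronecker_mul, mul_one, one_mul]

theorem ActsOn.mul_apply_self (hA : ActsOn S A) (hB : ActsOn T B) (h : Disjoint S T)
    (x : Fin n → Fin 2) : (A * B) x x = A x x * B x x := by
  obtain ⟨A', hA'⟩ := actsOn_iff_splitOp.1 hA
  obtain ⟨B', hB'⟩ := actsOn_compl_iff_splitOp.1 (hB.compl_of_disjoint h)
  simp only [← splitOp_splitBits S, map_mul, hA', hB', ← mul_kronecker_mul, mul_one, one_mul,
    kroneckerMap_apply, one_apply_eq]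

theorem actsOn_of_commute (h : ∀ B, ActsOn Sᶜ B → Commute A B) : ActsOn S A :=
  actsOn_iff_splitOp.2 <| exists_eq_kronecker_one_of_commute fun B => by
    simpa only [splitOp_extendOp_compl] using (h (extendOp Sᶜ B) ⟨B, rfl⟩).map (splitOp S)

end Locality

/-! ### Lightcones -/

section Lightcone

variable {n : ℕ} {S T : Finset (Fin n)} {i j : Fin n}

theorem Layer.mem_lightcone {L : Layer n} :
    i ∈ L.lightcone S ↔ ∃ a ∈ S, ∃ G ∈ L.gates, a ∈ G.block ∧ i ∈ G.block := by
  simp only [Layer.lightcone, Finset.mem_union, Finset.mem_filter, Finset.mem_univ, true_and]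
  constructor
  · rintro (hi | ⟨G, hG, ⟨a, ha⟩, hi⟩)
    · obtain ⟨G, hG, hiG⟩ := L.cover i
      exact ⟨i, hi, G, hG, hiG, hiG⟩
    · exact ⟨a, Finset.mem_of_mem_inter_right ha, G, hG, Finset.mem_of_mem_inter_left ha, hi⟩
  · rintro ⟨a, ha, G, hG, haG, hi⟩
    exact .inr ⟨G, hG, ⟨a, Finset.mem_inter.2 ⟨haG, ha⟩⟩, hi⟩

theorem Layer.mem_lightcone_singleton {L : Layer n} :
    i ∈ L.lightcone {j} ↔ ∃ G ∈ L.gates, j ∈ G.block ∧ i ∈ G.block := by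
  simp only [mem_lightcone, Finset.mem_singleton, exists_eq_left]

theorem Layer.mem_lightcone_iff_exists_singleton {L : Layer n} :
    i ∈ L.lightcone S ↔ ∃ a ∈ S, i ∈ L.lightcone {a} := by
  simp only [mem_lightcone_singleton, mem_lightcone (S := S)]

theorem Layer.mem_lightcone_singleton_comm {L : Layer n} :
    i ∈ L.lightcone {j} ↔ j ∈ L.lightcone {i} := by
  simp only [mem_lightcone_singleton, and_comm]

theorem Layer.subset_lightcone (L : Layer n) (S : Finset (Fin n)) : S ⊆ L.lightcone S :=
  Finset.subset_union_left

theorem Layer.eq_of_mem_block {L : Layer n} {G G' : Gate n} (hG : G ∈ L.gates)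
    (hG' : G' ∈ L.gates) (hi : i ∈ G.block) (hi' : i ∈ G'.block) : G = G' := by
  by_contra hne
  have hdisj : Disjoint G.block G'.block := L.pairwise_disjoint.forall hG hG' hne
  exact Finset.disjoint_left.1 hdisj hi hi'

theorem Layer.block_subset_lightcone_or_disjoint (L : Layer n) (S : Finset (Fin n)) {G : Gate n}
    (hG : G ∈ L.gates) : G.block ⊆ L.lightcone S ∨ Disjoint G.block (L.lightcone S) := by
  refine or_iff_not_imp_right.2 fun hmeet i hi => ?_
  obtain ⟨j, hj, hjS⟩ := Finset.not_disjoint_iff.1 hmeet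
  obtain ⟨a, ha, G', hG', haG', hjG'⟩ := mem_lightcone.1 hjS
  obtain rfl := eq_of_mem_block hG hG' hj hjG'
  exact mem_lightcone.2 ⟨a, ha, G, hG, haG', hi⟩

theorem Circuit.lightcone_cons (L : Layer n) (C : Circuit n) (S : Finset (Fin n)) :
    Circuit.lightcone (L :: C) S = C.lightcone (L.lightcone S) :=
  rfl

theorem Circuit.lightcone_append (C D : Circuit n) (S : Finset (Fin n)) :
    Circuit.lightcone (C ++ D) S = D.lightcone (C.lightcone S) :=
  List.foldl_append

theorem Circuit.lightcone_reverse_cons (L : Layer n) (C : Circuit n) (S : Finset (Fin n)) :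
    Circuit.lightcone (L :: C).reverse S = L.lightcone (Circuit.lightcone C.reverse S) := by
  rw [List.reverse_cons, lightcone_append]
  rfl

theorem Circuit.mem_lightcone_iff_exists_singleton {C : Circuit n} :
    i ∈ C.lightcone S ↔ ∃ a ∈ S, i ∈ C.lightcone {a} := by
  induction C generalizing S with
  | nil => simp [Circuit.lightcone]
  | cons L C ih =>
    simp only [lightcone_cons, ih (S := L.lightcone _),
      Layer.mem_lightcone_iff_exists_singleton (S := S)]
    tauto

theorem Circuit.mem_lightcone_reverse {C : Circuit n} :
    i ∈ Circuit.lightcone C.reverse {j} ↔ j ∈ C.lightcone {i} := by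
  induction C generalizing i with
  | nil => simp [Circuit.lightcone, eq_comm]
  | cons L C ih =>
    rw [lightcone_reverse_cons, lightcone_cons, Layer.mem_lightcone_iff_exists_singleton,
      mem_lightcone_iff_exists_singleton]
    simp only [ih, Layer.mem_lightcone_singleton_comm (i := i), and_comm]

theorem Circuit.disjoint_lightcone_reverse_iff {C : Circuit n} :
    Disjoint (Circuit.lightcone C.reverse S) (Circuit.lightcone C.reverse T) ↔
      Disjoint (Circuit.lightcone (C.reverse ++ C) S) T := by
  simp only [lightcone_append, Finset.disjoint_left,
    mem_lightcone_iff_exists_singleton (C := C.reverse) (S := T),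
    mem_lightcone_iff_exists_singleton (C := C) (S := Circuit.lightcone C.reverse S),
    mem_lightcone_reverse (C := C)]
  exact ⟨fun h j ⟨i, hi, hij⟩ hj => h hi ⟨j, hj, hij⟩,
    fun h i hi ⟨j, hj, hij⟩ => h ⟨i, hi, hij⟩ hj⟩

end Lightcone

/-! ### Gates, layers and circuits in the Heisenberg picture -/

section Heisenberg

variable {n : ℕ} {U V : Finset (Fin n)} {A B : Op (Fin n)}

/-- The action of a gate on observables, dual to its action on states. -/
def Gate.dual (G : Gate n) (A : Op (Fin n)) : Op (Fin n) :=
  (splitOp G.block).symm (tensorId (traceDual G.chan.toLin) (splitOp G.block A))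

theorem Gate.splitOp_apply (G : Gate n) (X : Op (Fin n)) :
    splitOp G.block (G.apply X) = tensorId G.chan.toLin (splitOp G.block X) := by
  ext p q
  obtain ⟨x, rfl⟩ := (splitBits G.block).surjective p
  obtain ⟨y, rfl⟩ := (splitBits G.block).surjective q
  rw [splitOp_splitBits]
  rfl

theorem Gate.splitOp_dual (G : Gate n) (A : Op (Fin n)) :
    splitOp G.block (G.dual A) = tensorId (traceDual G.chan.toLin) (splitOp G.block A) :=
  (splitOp G.block).apply_symm_apply _

theorem Gate.trace_apply_mul (G : Gate n) (X A : Op (Fin n)) :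
    (G.apply X * A).trace = (X * G.dual A).trace := by
  rw [← trace_splitOp G.block, map_mul, splitOp_apply, trace_tensorId_mul, ← splitOp_dual,
    ← map_mul, trace_splitOp]

theorem Gate.dual_one (G : Gate n) : G.dual 1 = 1 := by
  refine (splitOp G.block).injective ?_
  rw [splitOp_dual, map_one, ← one_kronecker_one, tensorId_kronecker,
    traceDual_one _ G.chan.tracePreserving]

theorem Gate.dual_mul_right (G : Gate n) (A : Op (Fin n)) (hB : ActsOn V B)
    (h : Disjoint G.block V) : G.dual (A * B) = G.dual A * B := by
  obtain ⟨B', hB'⟩ := actsOn_compl_iff_splitOp.1 (hB.compl_of_disjoint h)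
  refine (splitOp G.block).injective ?_
  simp only [splitOp_dual, map_mul, hB', tensorId_mul_one_kronecker]

theorem Gate.dual_mul_left (G : Gate n) (A : Op (Fin n)) (hB : ActsOn V B)
    (h : Disjoint G.block V) : G.dual (B * A) = B * G.dual A := by
  obtain ⟨B', hB'⟩ := actsOn_compl_iff_splitOp.1 (hB.compl_of_disjoint h)
  refine (splitOp G.block).injective ?_
  simp only [splitOp_dual, map_mul, hB', tensorId_one_kronecker_mul]

theorem Gate.dual_eq_self (G : Gate n) (hB : ActsOn V B) (h : Disjoint G.block V) :
    G.dual B = B := by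
  simpa only [one_mul, dual_one] using G.dual_mul_right 1 hB h

theorem Gate.actsOn_dual (G : Gate n) (hA : ActsOn U A)
    (h : G.block ⊆ U ∨ Disjoint G.block U) : ActsOn U (G.dual A) := by
  rcases h with hsub | hdisj
  · refine actsOn_of_commute fun B hB => ?_
    have hoff : Disjoint G.block Uᶜ := disjoint_compl_right.mono_left hsub
    rw [Commute, SemiconjBy, ← G.dual_mul_right A hB hoff, ← G.dual_mul_left A hB hoff,
      (hA.commute hB disjoint_compl_right).eq]
  · rwa [G.dual_eq_self hA hdisj]

theorem Gate.dual_mul (G : Gate n) (hA : ActsOn U A) (hB : ActsOn V B)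
    (h : Disjoint G.block U ∨ Disjoint G.block V) : G.dual (A * B) = G.dual A * G.dual B := by
  rcases h with hU | hV
  · rw [G.dual_mul_left B hA hU, G.dual_eq_self hA hU]
  · rw [G.dual_mul_right A hB hV, G.dual_eq_self hB hV]

/-- The action of a layer on observables, dual to its action on states. -/
def Layer.dual (L : Layer n) (A : Op (Fin n)) : Op (Fin n) :=
  L.gates.foldr Gate.dual A

/-- The action of a circuit on observables, dual to its action on states: the last layer acts
first. -/
def Circuit.dual (C : Circuit n) (A : Op (Fin n)) : Op (Fin n) :=
  List.foldr Layer.dual A C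

theorem Layer.trace_apply_mul (L : Layer n) (X A : Op (Fin n)) :
    (L.apply X * A).trace = (X * L.dual A).trace := by
  unfold Layer.apply Layer.dual
  induction L.gates generalizing X with
  | nil => rfl
  | cons G Gs ih => rw [List.foldl_cons, ih, G.trace_apply_mul, List.foldr_cons]

theorem Circuit.trace_apply_mul (C : Circuit n) (X A : Op (Fin n)) :
    (C.apply X * A).trace = (X * C.dual A).trace := by
  unfold Circuit.apply Circuit.dual
  induction C generalizing X with
  | nil => rfl
  | cons L C ih => rw [List.foldl_cons, ih, L.trace_apply_mul, List.foldr_cons]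

theorem actsOn_foldr_dual {Gs : List (Gate n)} (hA : ActsOn U A)
    (h : ∀ G ∈ Gs, G.block ⊆ U ∨ Disjoint G.block U) : ActsOn U (Gs.foldr Gate.dual A) := by
  induction Gs with
  | nil => exact hA
  | cons G Gs ih =>
    rw [List.forall_mem_cons] at h
    exact G.actsOn_dual (ih h.2) h.1

theorem foldr_dual_mul {Gs : List (Gate n)} (hA : ActsOn U A) (hB : ActsOn V B)
    (hU : ∀ G ∈ Gs, G.block ⊆ U ∨ Disjoint G.block U)
    (hV : ∀ G ∈ Gs, G.block ⊆ V ∨ Disjoint G.block V) (hUV : Disjoint U V) :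
    Gs.foldr Gate.dual (A * B) = Gs.foldr Gate.dual A * Gs.foldr Gate.dual B := by
  induction Gs with
  | nil => rfl
  | cons G Gs ih =>
    rw [List.forall_mem_cons] at hU hV
    have hG : Disjoint G.block U ∨ Disjoint G.block V :=
      hU.1.symm.imp_right fun hsub => hUV.mono_left hsub
    rw [List.foldr_cons, ih hU.2 hV.2,
      G.dual_mul (actsOn_foldr_dual hA hU.2) (actsOn_foldr_dual hB hV.2) hG]
    rfl

theorem Layer.actsOn_dual (L : Layer n) (hA : ActsOn U A) :
    ActsOn (L.lightcone U) (L.dual A) :=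
  actsOn_foldr_dual (hA.mono (L.subset_lightcone U)) fun _ =>
    L.block_subset_lightcone_or_disjoint U

theorem Layer.dual_mul (L : Layer n) (hA : ActsOn U A) (hB : ActsOn V B)
    (h : Disjoint (L.lightcone U) (L.lightcone V)) : L.dual (A * B) = L.dual A * L.dual B :=
  foldr_dual_mul (hA.mono (L.subset_lightcone U)) (hB.mono (L.subset_lightcone V))
    (fun _ => L.block_subset_lightcone_or_disjoint U)
    (fun _ => L.block_subset_lightcone_or_disjoint V) h

theorem Circuit.actsOn_dual (C : Circuit n) (hA : ActsOn U A) :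
    ActsOn (Circuit.lightcone C.reverse U) (C.dual A) := by
  induction C with
  | nil => exact hA
  | cons L C ih =>
    rw [lightcone_reverse_cons]
    exact L.actsOn_dual ih

theorem Circuit.dual_mul (C : Circuit n) (hA : ActsOn U A) (hB : ActsOn V B)
    (h : Disjoint (Circuit.lightcone C.reverse U) (Circuit.lightcone C.reverse V)) :
    C.dual (A * B) = C.dual A * C.dual B := by
  induction C with
  | nil => rfl
  | cons L C ih =>
    rw [lightcone_reverse_cons, lightcone_reverse_cons] at h
    have hC := h.mono (L.subset_lightcone _) (L.subset_lightcone _)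
    exact (congrArg L.dual (ih hC)).trans (L.dual_mul (actsOn_dual C hA) (actsOn_dual C hB) h)

/-- The expectation value of the observable `A` in the state `ρ`. -/
def QState.expect (ρ : QState n) : Op (Fin n) →ₗ[ℂ] ℂ :=
  Matrix.traceLinearMap _ ℂ ℂ ∘ₗ LinearMap.mulLeft ℂ ρ.mat

theorem QState.expect_apply (ρ : QState n) (A : Op (Fin n)) : ρ.expect A = (ρ.mat * A).trace :=
  rfl

theorem Circuit.Prepares.expect_eq {C : Circuit n} {ρ : QState n} (h : C.Prepares ρ)
    (A : Op (Fin n)) : ρ.expect A = C.dual A 0 0 := by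
  rw [QState.expect_apply, ← h, C.trace_apply_mul, zeroState, Matrix.trace_single_mul, one_smul]

theorem Circuit.Prepares.expect_mul {C : Circuit n} {ρ : QState n} (h : C.Prepares ρ)
    (hA : ActsOn U A) (hB : ActsOn V B)
    (hd : Disjoint (Circuit.lightcone C.reverse U) (Circuit.lightcone C.reverse V)) :
    ρ.expect (A * B) = ρ.expect A * ρ.expect B := by
  rw [h.expect_eq, h.expect_eq, h.expect_eq, C.dual_mul hA hB hd,
    (C.actsOn_dual hA).mul_apply_self (C.actsOn_dual hB) hd]

end Heisenberg

/-! ### Quantum Fisher information and covariance -/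

section Spectral

variable {𝕜 d : Type*} [RCLike 𝕜] [Fintype d] [DecidableEq d] {M A : Matrix d d 𝕜}

theorem trace_mul_eq_sum_eigenvalues (hM : M.IsHermitian) (A : Matrix d d 𝕜) :
    (M * A).trace = ∑ i, (hM.eigenvalues i : 𝕜) *
      inner 𝕜 (hM.eigenvectorBasis i) (A.toEuclideanLin (hM.eigenvectorBasis i)) := by
  have heigen : ∀ i, M.toEuclideanLin (hM.eigenvectorBasis i) =
      (hM.eigenvalues i : 𝕜) • hM.eigenvectorBasis i := fun i => by
    ext x
    simpa [RCLike.real_smul_eq_coe_mul] using congrFun (hM.mulVec_eigenvectorBasis i) x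
  have htrace : (A * M).trace = (A * M).toEuclideanLin.trace 𝕜 _ := by
    rw [Matrix.toEuclideanLin_eq_toLin_orthonormal, Matrix.trace_toLin_eq]
  rw [Matrix.trace_mul_comm, htrace, LinearMap.trace_eq_sum_inner _ hM.eigenvectorBasis]
  refine Finset.sum_congr rfl fun i _ => ?_
  rw [toLpLin_mul_same, LinearMap.comp_apply, heigen, map_smul, inner_smul_right]

theorem trace_mul_mul_self (hM : M.IsHermitian) (hA : A.IsHermitian) :
    (M * (A * A)).trace = ((∑ i, hM.eigenvalues i *
      ‖A.toEuclideanLin (hM.eigenvectorBasis i)‖ ^ 2 : ℝ) : 𝕜) := by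
  rw [trace_mul_eq_sum_eigenvalues hM]
  push_cast
  refine Finset.sum_congr rfl fun i _ => ?_
  rw [toLpLin_mul_same, LinearMap.comp_apply, ← isSymmetric_toEuclideanLin_iff.2 hA _ _,
    inner_self_eq_norm_sq_to_K]

theorem sum_sum_add_mul_sq_norm_inner {ι E : Type*} [Fintype ι] [NormedAddCommGroup E]
    [InnerProductSpace 𝕜 E] (b : OrthonormalBasis ι 𝕜 E) (w : ι → ℝ) {T : E →ₗ[𝕜] E}
    (hT : T.IsSymmetric) :
    ∑ i, ∑ j, (w i + w j) * ‖inner 𝕜 (b i) (T (b j))‖ ^ 2 = 2 * ∑ i, w i * ‖T (b i)‖ ^ 2 := by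
  have hleft : ∑ i, ∑ j, w i * ‖inner 𝕜 (b i) (T (b j))‖ ^ 2 = ∑ i, w i * ‖T (b i)‖ ^ 2 := by
    simp only [← hT _ _, ← Finset.mul_sum, b.sum_sq_norm_inner_left]
  have hright : ∑ i, ∑ j, w j * ‖inner 𝕜 (b i) (T (b j))‖ ^ 2 = ∑ i, w i * ‖T (b i)‖ ^ 2 := by
    rw [Finset.sum_comm]
    simp only [← Finset.mul_sum, b.sum_sq_norm_inner_right]
  simp only [add_mul, Finset.sum_add_distrib, hleft, hright, two_mul]

theorem sub_sq_div_add_le_add {a b : ℝ} (ha : 0 ≤ a) (hb : 0 ≤ b) :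
    (a - b) ^ 2 / (a + b) ≤ a + b :=
  div_le_of_le_mul₀ (add_nonneg ha hb) (add_nonneg ha hb) (by nlinarith [mul_nonneg ha hb])

end Spectral

section Covariance

variable {n : ℕ} (ρ : QState n) {A B H : Op (Fin n)}

theorem QState.expect_one : ρ.expect 1 = 1 := by
  rw [expect_apply, mul_one, ρ.trace_eq_one]

theorem QState.star_expect (A : Op (Fin n)) : star (ρ.expect A) = ρ.expect Aᴴ := by
  rw [expect_apply, expect_apply, ← Matrix.trace_conjTranspose, Matrix.conjTranspose_mul,
    ρ.posSemidef.isHermitian.eq, Matrix.trace_mul_comm]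

/-- The fluctuation of an observable about its expectation value. -/
def QState.center (A : Op (Fin n)) : Op (Fin n) :=
  A - ρ.expect A • 1

/-- The covariance `⟨AB⟩ - ⟨A⟩⟨B⟩` of observables in the state `ρ`, as a bilinear map. -/
def QState.cov : Op (Fin n) →ₗ[ℂ] Op (Fin n) →ₗ[ℂ] ℂ :=
  (LinearMap.mul ℂ (Op (Fin n))).compr₂ ρ.expect -
    (LinearMap.mul ℂ ℂ).compl₁₂ ρ.expect ρ.expect

theorem QState.cov_apply (A B : Op (Fin n)) :
    ρ.cov A B = ρ.expect (A * B) - ρ.expect A * ρ.expect B :=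
  rfl

theorem QState.expect_center_mul_center (A B : Op (Fin n)) :
    ρ.expect (ρ.center A * ρ.center B) = ρ.cov A B := by
  simp only [center, cov_apply, sub_mul, mul_sub, smul_mul_assoc, mul_smul_comm, one_mul, mul_one,
    map_sub, map_smul, expect_one, smul_eq_mul]
  ring

theorem QState.isHermitian_center (hA : A.IsHermitian) : (ρ.center A).IsHermitian := by
  rw [center, Matrix.IsHermitian, Matrix.conjTranspose_sub, Matrix.conjTranspose_smul,
    Matrix.conjTranspose_one, ρ.star_expect, hA.eq]

theorem QState.star_cov (A B : Op (Fin n)) : star (ρ.cov A B) = ρ.cov Bᴴ Aᴴ := by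
  rw [cov_apply, cov_apply, star_sub, star_mul', ρ.star_expect, ρ.star_expect, ρ.star_expect,
    Matrix.conjTranspose_mul, mul_comm (ρ.expect Aᴴ)]

theorem qfi_nonneg (H : Op (Fin n)) : 0 ≤ qfi ρ H := by
  have hev := ρ.posSemidef.eigenvalues_nonneg
  refine mul_nonneg (by norm_num) (Finset.sum_nonneg fun i _ => Finset.sum_nonneg fun j _ => ?_)
  split_ifs
  · exact mul_nonneg (div_nonneg (sq_nonneg _) (add_nonneg (hev i) (hev j))) (sq_nonneg _)
  · exact le_rfl

theorem qfi_sub_smul_one (H : Op (Fin n)) (c : ℂ) : qfi ρ (H - c • 1) = qfi ρ H := by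
  refine congrArg (1 / 2 * ·) (Finset.sum_congr rfl fun i _ => Finset.sum_congr rfl fun j _ => ?_)
  rcases eq_or_ne i j with rfl | hij
  · simp
  · simp [OrthonormalBasis.inner_eq_zero _ hij]

theorem qfi_le_expect_mul_self (hH : H.IsHermitian) : qfi ρ H ≤ (ρ.expect (H * H)).re := by
  have hev := ρ.posSemidef.eigenvalues_nonneg
  set b := ρ.posSemidef.isHermitian.eigenvectorBasis
  set ev := ρ.posSemidef.isHermitian.eigenvalues
  calc qfi ρ H
      ≤ 1 / 2 * ∑ i, ∑ j, (ev i + ev j) * ‖inner ℂ (b i) (H.toEuclideanLin (b j))‖ ^ 2 := by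
        refine mul_le_mul_of_nonneg_left (Finset.sum_le_sum fun i _ => Finset.sum_le_sum
          fun j _ => ?_) (by norm_num)
        split_ifs
        · exact mul_le_mul_of_nonneg_right (sub_sq_div_add_le_add (hev i) (hev j)) (sq_nonneg _)
        · exact mul_nonneg (add_nonneg (hev i) (hev j)) (sq_nonneg _)
    _ = ∑ i, ev i * ‖H.toEuclideanLin (b i)‖ ^ 2 := by
        rw [sum_sum_add_mul_sq_norm_inner b ev (isSymmetric_toEuclideanLin_iff.2 hH)]
        ring
    _ = (ρ.expect (H * H)).re := by
        rw [ρ.expect_apply, trace_mul_mul_self ρ.posSemidef.isHermitian hH]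
        exact (Complex.ofReal_re _).symm

theorem qfi_le_cov_self (hH : H.IsHermitian) : qfi ρ H ≤ (ρ.cov H H).re := by
  rw [← qfi_sub_smul_one ρ H (ρ.expect H), ← ρ.expect_center_mul_center]
  exact qfi_le_expect_mul_self ρ (ρ.isHermitian_center hH)

theorem QState.expect_mul_self_le_one (hA : A.IsHermitian)
    (hA1 : ‖toEuclideanCLM (n := Fin n → Fin 2) (𝕜 := ℂ) A‖ ≤ 1) :
    (ρ.expect (A * A)).re ≤ 1 := by
  have hsum : ∑ i, ρ.posSemidef.isHermitian.eigenvalues i = 1 := by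
    simpa using congrArg Complex.re
      (ρ.posSemidef.isHermitian.trace_eq_sum_eigenvalues.symm.trans ρ.trace_eq_one)
  set b := ρ.posSemidef.isHermitian.eigenvectorBasis
  set ev := ρ.posSemidef.isHermitian.eigenvalues
  have hnorm : ∀ i, ‖A.toEuclideanLin (b i)‖ ≤ 1 := fun i =>
    ((toEuclideanCLM (𝕜 := ℂ) A).le_of_opNorm_le hA1 (b i)).trans_eq
      (by rw [b.norm_eq_one, mul_one])
  calc (ρ.expect (A * A)).re
      = ∑ i, ev i * ‖A.toEuclideanLin (b i)‖ ^ 2 := by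
        rw [ρ.expect_apply, trace_mul_mul_self ρ.posSemidef.isHermitian hA]
        exact Complex.ofReal_re _
    _ ≤ ∑ i, ev i := Finset.sum_le_sum fun i _ => mul_le_of_le_one_right
        (ρ.posSemidef.eigenvalues_nonneg i) (pow_le_one₀ (norm_nonneg _) (hnorm i))
    _ = 1 := hsum

theorem QState.cov_self_le_one (hA : A.IsHermitian)
    (hA1 : ‖toEuclideanCLM (n := Fin n → Fin 2) (𝕜 := ℂ) A‖ ≤ 1) : (ρ.cov A A).re ≤ 1 := by
  have him : (ρ.expect A).im = 0 := Complex.conj_eq_iff_im.1 <| by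
    rw [starRingEnd_apply, star_expect, hA.eq]
  rw [cov_apply, Complex.sub_re, Complex.mul_re, him, mul_zero, sub_zero]
  linarith [ρ.expect_mul_self_le_one hA hA1, mul_self_nonneg (ρ.expect A).re]

theorem QState.two_mul_cov_le (hA : A.IsHermitian) (hB : B.IsHermitian) :
    2 * (ρ.cov A B).re ≤ (ρ.cov A A).re + (ρ.cov B B).re := by
  have hnonneg : 0 ≤ (ρ.cov (A - B) (A - B)).re :=
    (qfi_nonneg ρ _).trans (qfi_le_cov_self ρ (hA.sub hB))
  have hsymm : (ρ.cov B A).re = (ρ.cov A B).re := by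
    rw [← Complex.conj_re, starRingEnd_apply, star_cov, hA.eq, hB.eq]
  simp only [map_sub, LinearMap.sub_apply, Complex.sub_re, hsymm] at hnonneg
  linarith

theorem Circuit.Prepares.cov_eq_zero {ρ : QState n} {C : Circuit n} {S T : Finset (Fin n)}
    (h : C.Prepares ρ) (hA : ActsOn S A) (hB : ActsOn T B)
    (hd : Disjoint (Circuit.lightcone C.reverse S) (Circuit.lightcone C.reverse T)) :
    ρ.cov A B = 0 :=
  sub_eq_zero.2 (h.expect_mul hA hB hd)

end Covariance

/-! ### Local Hamiltonians -/

section LocalHamiltonian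

variable {n m K : ℕ} (H : LocalHamiltonian n m K)

theorem LocalHamiltonian.isHermitian_total : H.total.IsHermitian := by
  rw [Matrix.IsHermitian, total, Matrix.conjTranspose_sum]
  exact Finset.sum_congr rfl fun j _ => H.isHermitian j

theorem LocalHamiltonian.cov_term_le_one (ρ : QState n) (j k : Fin m) :
    (ρ.cov (H.term j) (H.term k)).re ≤ 1 := by
  linarith [ρ.two_mul_cov_le (H.isHermitian j) (H.isHermitian k),
    ρ.cov_self_le_one (H.isHermitian j) (H.norm_le_one j),
    ρ.cov_self_le_one (H.isHermitian k) (H.norm_le_one k)]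

theorem LocalHamiltonian.card_meeting_le (S : Finset (Fin n)) :
    (Finset.univ.filter fun k => ¬ Disjoint S (supp (H.term k))).card ≤ S.card * K := by
  refine (Finset.card_le_card fun k hk => ?_).trans
    (Finset.card_biUnion_le_card_mul S (fun i => {k | i ∈ supp (H.term k)}) K
      fun i _ => H.degree_le i)
  simpa [Finset.not_disjoint_iff] using hk

theorem Circuit.card_lightcone_le_card_mul {C : Circuit n} {g : ℕ}
    (hg : ∀ q, (C.lightcone {q}).card ≤ g) (S : Finset (Fin n)) :
    (C.lightcone S).card ≤ S.card * g := by
  refine (Finset.card_le_card fun i hi => ?_).trans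
    (Finset.card_biUnion_le_card_mul S (fun q => C.lightcone {q}) g fun q _ => hg q)
  simpa using mem_lightcone_iff_exists_singleton.1 hi

theorem qfi_le_sum_card_meeting {ρ : QState n} {C : Circuit n} (hC : C.Prepares ρ) :
    qfi ρ H.total ≤ ∑ j, ((Finset.univ.filter fun k => ¬ Disjoint
      (Circuit.lightcone (C.reverse ++ C) (supp (H.term j))) (supp (H.term k))).card : ℝ) := by
  calc qfi ρ H.total ≤ (ρ.cov H.total H.total).re := qfi_le_cov_self ρ H.isHermitian_total
    _ = ∑ j, ∑ k, (ρ.cov (H.term j) (H.term k)).re := by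
        simp only [LocalHamiltonian.total, map_sum, LinearMap.sum_apply, Complex.re_sum]
        exact Finset.sum_comm
    _ ≤ _ := by
        refine Finset.sum_le_sum fun j _ => ?_
        rw [← Finset.sum_boole]
        refine Finset.sum_le_sum fun k _ => ?_
        split_ifs with h
        · have hd := Circuit.disjoint_lightcone_reverse_iff.2 h
          rw [hC.cov_eq_zero (actsOn_supp _) (actsOn_supp _) hd, Complex.zero_re]
        · exact H.cov_term_le_one ρ j k

theorem qfi_le_of_card_lightcone_le {ρ : QState n} {C : Circuit n} (hC : C.Prepares ρ) {g : ℕ}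
    (hg : ∀ q, (Circuit.lightcone (C.reverse ++ C) {q}).card ≤ g) :
    qfi ρ H.total ≤ m * K ^ 2 * g := by
  have hcard : ∀ j, (Finset.univ.filter fun k => ¬ Disjoint
      (Circuit.lightcone (C.reverse ++ C) (supp (H.term j))) (supp (H.term k))).card ≤
        K * g * K := fun j =>
    calc _ ≤ (Circuit.lightcone (C.reverse ++ C) (supp (H.term j))).card * K :=
          H.card_meeting_le _
      _ ≤ (supp (H.term j)).card * g * K :=
          Nat.mul_le_mul_right _ (Circuit.card_lightcone_le_card_mul hg _)
      _ ≤ K * g * K := by gcongr; exact H.card_supp_le j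
  calc qfi ρ H.total ≤ ∑ _j : Fin m, ((K * g * K : ℕ) : ℝ) :=
        (qfi_le_sum_card_meeting H hC).trans
          (Finset.sum_le_sum fun j _ => by exact_mod_cast hcard j)
    _ = m * K ^ 2 * g := by
        rw [Finset.sum_const, Finset.card_univ, Fintype.card_fin, nsmul_eq_mul]
        push_cast
        ring

end LocalHamiltonian

/-! ### Growth of lightcones -/

section Growth

variable {n : ℕ} {𝒢 : Connectivity n} {C D : Circuit n} {L : Layer n}

theorem Circuit.obeys_cons :
    Circuit.Obeys (L :: C) 𝒢 ↔ (∀ G ∈ L.gates, G.block ∈ 𝒢) ∧ C.Obeys 𝒢 :=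
  List.forall_mem_cons

theorem Circuit.Obeys.append (hC : C.Obeys 𝒢) (hD : D.Obeys 𝒢) : Circuit.Obeys (C ++ D) 𝒢 :=
  List.forall_mem_append.2 ⟨hC, hD⟩

theorem Circuit.Obeys.reverse (hC : C.Obeys 𝒢) : Circuit.Obeys C.reverse 𝒢 := fun L hL =>
  hC L (List.mem_reverse.1 hL)

theorem Circuit.depth_cons (L : Layer n) (C : Circuit n) :
    Circuit.depth (L :: C) = C.depth + 1 :=
  rfl

theorem Circuit.depth_reverse_append (C : Circuit n) :
    Circuit.depth (C.reverse ++ C) = 2 * C.depth := by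
  rw [depth, depth, List.length_append, List.length_reverse, two_mul]

theorem mem_diffusion {t : ℕ} {S : Finset (Fin n)} {i : Fin n} :
    i ∈ diffusion 𝒢 t S ↔ ∃ C : Circuit n, C.depth = t ∧ C.Obeys 𝒢 ∧ i ∈ C.lightcone S := by
  simp only [diffusion, Finset.mem_filter, Finset.mem_univ, true_and]

theorem card_diffusion_le_growth (𝒢 : Connectivity n) (t : ℕ) (q : Fin n) :
    (diffusion 𝒢 t {q}).card ≤ growth 𝒢 t :=
  Finset.le_sup (f := fun q => (diffusion 𝒢 t {q}).card) (Finset.mem_univ q)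

theorem Circuit.Obeys.card_lightcone_le_growth (hC : C.Obeys 𝒢) (q : Fin n) :
    (C.lightcone {q}).card ≤ growth 𝒢 C.depth :=
  (Finset.card_le_card fun _ hi => mem_diffusion.2 ⟨C, rfl, hC, hi⟩).trans
    (card_diffusion_le_growth 𝒢 C.depth q)

theorem Layer.card_lightcone_le {κ : ℕ} (h : ∀ G ∈ L.gates, G.block.card ≤ κ)
    (S : Finset (Fin n)) : (L.lightcone S).card ≤ S.card * κ := by
  choose G hG hmem using L.cover
  have hsub : L.lightcone S ⊆ S.biUnion fun a => (G a).block := fun i hi => by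
    obtain ⟨a, ha, G', hG', haG', hiG'⟩ := mem_lightcone.1 hi
    obtain rfl := eq_of_mem_block (hG a) hG' (hmem a) haG'
    exact Finset.mem_biUnion.2 ⟨a, ha, hiG'⟩
  exact (Finset.card_le_card hsub).trans
    (Finset.card_biUnion_le_card_mul _ _ _ fun a _ => h _ (hG a))

theorem Circuit.Obeys.card_lightcone_le {κ : ℕ} (hC : C.Obeys (allToAll n κ))
    (S : Finset (Fin n)) : (C.lightcone S).card ≤ S.card * κ ^ C.depth := by
  induction C generalizing S with
  | nil => simp [Circuit.lightcone, Circuit.depth]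
  | cons L C ih =>
    obtain ⟨hL, hC⟩ := obeys_cons.1 hC
    calc (Circuit.lightcone C (L.lightcone S)).card
        ≤ (L.lightcone S).card * κ ^ Circuit.depth C := ih hC _
      _ ≤ S.card * κ * κ ^ Circuit.depth C := Nat.mul_le_mul_right _ (L.card_lightcone_le hL S)
      _ = S.card * κ ^ Circuit.depth (L :: C) := by rw [depth_cons, pow_succ', mul_assoc]

end Growth

/-! ### Growth of lightcones on a lattice -/

section Lattice

variable {n r k t : ℕ} {pos : Fin n → Fin r → ℤ} {C : Circuit n} {p q : Fin n}

/-- The box of lattice sites within sup-norm distance `d` of `c`. -/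
def latticeBox (c : Fin r → ℤ) (d : ℕ) : Finset (Fin r → ℤ) :=
  Fintype.piFinset fun i => Finset.Icc (c i - d) (c i + d)

theorem mem_latticeBox {c v : Fin r → ℤ} {d : ℕ} :
    v ∈ latticeBox c d ↔ ∀ i, |v i - c i| ≤ d := by
  simp only [latticeBox, Fintype.mem_piFinset, Finset.mem_Icc]
  exact forall_congr' fun i => by rw [abs_le]; omega

theorem card_latticeBox (c : Fin r → ℤ) (d : ℕ) : (latticeBox c d).card = (2 * d + 1) ^ r := by
  have hside : ∀ i, (Finset.Icc (c i - d) (c i + d)).card = 2 * d + 1 := fun i => by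
    rw [Int.card_Icc]
    omega
  simp [latticeBox, hside]

theorem Circuit.Obeys.pos_mem_latticeBox (hC : C.Obeys (lattice pos (k + 1)))
    (hq : q ∈ C.lightcone {p}) : pos q ∈ latticeBox (pos p) (k * C.depth) := by
  refine mem_latticeBox.2 fun i => ?_
  induction C generalizing p with
  | nil => simp [Finset.mem_singleton.1 hq, Circuit.depth]
  | cons L C ih =>
    obtain ⟨hL, hC⟩ := obeys_cons.1 hC
    obtain ⟨a, ha, hqa⟩ := (Circuit.mem_lightcone_iff_exists_singleton (C := C)).1 hq
    obtain ⟨G, hG, hpG, haG⟩ := Layer.mem_lightcone_singleton.1 ha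
    obtain ⟨c, hc⟩ := hL G hG
    have hstep : |pos a i - pos p i| ≤ k := by
      have hp := hc p hpG i
      have ha := hc a haG i
      push_cast at hp ha
      exact abs_sub_le_iff.2 ⟨by linarith, by linarith⟩
    calc |pos q i - pos p i| ≤ |pos q i - pos a i| + |pos a i - pos p i| := abs_sub_le _ _ _
      _ ≤ (k * Circuit.depth C : ℕ) + k := add_le_add (ih hC hqa) hstep
      _ = (k * Circuit.depth (L :: C) : ℕ) := by rw [depth_cons, mul_add_one]; push_cast; rfl

theorem growth_lattice_le (hpos : Function.Injective pos) (k t : ℕ) :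
    growth (lattice pos (k + 1)) t ≤ (2 * (k * t) + 1) ^ r := by
  refine Finset.sup_le fun q _ => ?_
  rw [← card_latticeBox (pos q), ← Finset.card_image_of_injective _ hpos]
  refine Finset.card_le_card (Finset.image_subset_iff.2 fun p hp => ?_)
  obtain ⟨C, rfl, hC, hpC⟩ := mem_diffusion.1 hp
  exact hC.pos_mem_latticeBox hpC

/-- The identity channel. -/
def Channel.id (d : Type) [Fintype d] : Channel d where
  toLin := LinearMap.id
  completelyPositive _ _ h := h
  tracePreserving _ := rfl

/-- The layer of identity channels with the single two-qubit block `{p, q}`; it only serves to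
let lightcones spread from `p` to `q`. -/
def Layer.pair (p q : Fin n) : Layer n where
  gates := ⟨{p, q}, Channel.id _⟩ ::
    ((List.finRange n).filter fun i => i ≠ p ∧ i ≠ q).map fun i => ⟨{i}, Channel.id _⟩
  pairwise_disjoint := by
    refine List.pairwise_cons.2 ⟨fun G hG => ?_, List.pairwise_map.2 ?_⟩
    · obtain ⟨i, hi, rfl⟩ := List.mem_map.1 hG
      simpa using (List.mem_filter.1 hi).2
    · exact ((List.nodup_finRange n).filter _).imp fun hne => Finset.disjoint_singleton.2 hne
  cover i := by
    by_cases h : i = p ∨ i = q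
    · exact ⟨_, List.mem_cons_self, by simpa using h⟩
    · exact ⟨⟨{i}, Channel.id _⟩,
        List.mem_cons_of_mem _ (List.mem_map.2 ⟨i, by simpa using h, rfl⟩), by simp⟩

theorem Layer.mem_lightcone_pair (p q : Fin n) : q ∈ (Layer.pair p q).lightcone {p} :=
  mem_lightcone_singleton.2 ⟨_, List.mem_cons_self, by simp, by simp⟩

theorem mem_lattice_of_forall_abs_le {B : Finset (Fin n)}
    (h : ∀ p ∈ B, ∀ q ∈ B, ∀ i, |pos q i - pos p i| ≤ k) : B ∈ lattice pos (k + 1) := by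
  rcases B.eq_empty_or_nonempty with rfl | hB
  · exact ⟨0, by simp⟩
  · refine ⟨fun i => B.inf' hB (pos · i), fun q hq i => ⟨Finset.inf'_le _ hq, ?_⟩⟩
    obtain ⟨p, hp, hmin⟩ := Finset.exists_mem_eq_inf' hB (pos · i)
    simp only [hmin]
    push_cast
    linarith [(abs_le.1 (h p hp q hq i)).2]

theorem Layer.pair_block_mem_lattice (h : ∀ i, |pos q i - pos p i| ≤ k) :
    ∀ G ∈ (Layer.pair p q).gates, G.block ∈ lattice pos (k + 1) := by
  intro G hG
  refine mem_lattice_of_forall_abs_le ?_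
  rcases List.mem_cons.1 hG with rfl | hG
  · simpa [abs_sub_comm (pos p _)] using h
  · obtain ⟨a, -, rfl⟩ := List.mem_map.1 hG
    simp

theorem exists_abs_sub_le_and_abs_sub_le {x y : ℤ} {a b : ℕ} (h : |y - x| ≤ (a + b : ℕ)) :
    ∃ z, |z - x| ≤ a ∧ |y - z| ≤ b := by
  refine ⟨max (x - a) (min (x + a) y), ?_, ?_⟩ <;> simp only [abs_le] at h ⊢ <;> omega

theorem mem_diffusion_lattice_of_mem_latticeBox (hpos : Function.Injective pos)
    (hbox : ∀ v ∈ latticeBox (pos q) (k * t), ∃ q', pos q' = v)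
    (hp : pos p ∈ latticeBox (pos q) (k * t)) : p ∈ diffusion (lattice pos (k + 1)) t {q} := by
  refine mem_diffusion.2 ?_
  induction t generalizing p with
  | zero =>
    obtain rfl : p = q := hpos (funext fun i => by
      simpa [sub_eq_zero] using mem_latticeBox.1 hp i)
    exact ⟨[], rfl, List.forall_mem_nil _, Finset.mem_singleton_self p⟩
  | succ t ih =>
    have hmono : latticeBox (pos q) (k * t) ⊆ latticeBox (pos q) (k * (t + 1)) := fun v hv =>
      mem_latticeBox.2 fun i => (mem_latticeBox.1 hv i).trans (by push_cast; linarith)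
    choose z hz hpz using fun i => exists_abs_sub_le_and_abs_sub_le (mem_latticeBox.1 hp i)
    obtain ⟨a, rfl⟩ := hbox z (hmono (mem_latticeBox.2 hz))
    obtain ⟨C, rfl, hC, haC⟩ := ih (fun v hv => hbox v (hmono hv)) (mem_latticeBox.2 hz)
    have hpair : Circuit.Obeys [Layer.pair a p] (lattice pos (k + 1)) :=
      List.forall_mem_singleton.2 (Layer.pair_block_mem_lattice hpz)
    refine ⟨C ++ [Layer.pair a p], List.length_append, hC.append hpair, ?_⟩
    rw [Circuit.lightcone_append]
    exact Layer.mem_lightcone_iff_exists_singleton.2 ⟨a, haC, Layer.mem_lightcone_pair a p⟩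

theorem growth_lattice_eq (hpos : Function.Injective pos)
    (hbox : ∀ v ∈ latticeBox (pos q) (k * t), ∃ q', pos q' = v) :
    growth (lattice pos (k + 1)) t = (2 * (k * t) + 1) ^ r := by
  refine (growth_lattice_le hpos k t).antisymm ?_
  rw [← card_latticeBox (pos q)]
  refine le_trans ?_ (card_diffusion_le_growth _ t q)
  rw [← Finset.card_image_of_injective _ hpos]
  refine Finset.card_le_card fun v hv => ?_
  obtain ⟨p, rfl⟩ := hbox v hv
  exact Finset.mem_image_of_mem _ (mem_diffusion_lattice_of_mem_latticeBox hpos hbox hv)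

end Lattice

/-! ### Bounds on the quantum Fisher information -/

section Bounds

variable {n m K : ℕ} (H : LocalHamiltonian n m K) {ρ : QState n} {C : Circuit n}

theorem qfi_le_growth {𝒢 : Connectivity n} (hO : C.Obeys 𝒢) (hC : C.Prepares ρ) :
    qfi ρ H.total ≤ m * K ^ 2 * growth 𝒢 (2 * C.depth) := by
  rw [← Circuit.depth_reverse_append]
  exact qfi_le_of_card_lightcone_le H hC (hO.reverse.append hO).card_lightcone_le_growth

theorem qfi_le_allToAll {κ : ℕ} (hO : C.Obeys (allToAll n κ)) (hC : C.Prepares ρ) :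
    qfi ρ H.total ≤ m * K ^ 2 * κ ^ (2 * C.depth) := by
  rw [← Circuit.depth_reverse_append, ← Nat.cast_pow κ]
  refine qfi_le_of_card_lightcone_le H hC fun q => ?_
  simpa using (hO.reverse.append hO).card_lightcone_le {q}

theorem qfi_le_mul_of_depth_le {κ T : ℕ} {c : ℝ} (hm : m ≤ c * n) (hT : C.depth ≤ T)
    (hO : C.Obeys (allToAll n κ)) (hC : C.Prepares ρ) :
    qfi ρ H.total ≤ c * K ^ 2 * (κ + 1) ^ (2 * T) * n := by
  calc qfi ρ H.total ≤ m * K ^ 2 * κ ^ (2 * C.depth) := qfi_le_allToAll H hO hC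
    _ ≤ m * K ^ 2 * (κ + 1) ^ (2 * C.depth) := by gcongr; linarith
    _ ≤ m * K ^ 2 * (κ + 1) ^ (2 * T) := by gcongr; linarith
    _ ≤ (c * n) * K ^ 2 * (κ + 1) ^ (2 * T) := by gcongr
    _ = c * K ^ 2 * (κ + 1) ^ (2 * T) * n := by ring

theorem IsShallow.isBigO_qfi {l : Filter ℕ} {n m : ℕ → ℕ} {ρ : ∀ k, QState (n k)}
    (hρ : IsShallow ρ) (H : ∀ k, LocalHamiltonian (n k) (m k) K)
    (hm : (fun k => (m k : ℝ)) =O[l] fun k => (n k : ℝ)) :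
    (fun k => qfi (ρ k) (H k).total) =O[l] fun k => (n k : ℝ) := by
  obtain ⟨κ, T, hprep⟩ := hρ
  obtain ⟨c, hc⟩ := hm.bound
  refine IsBigO.of_bound (c * K ^ 2 * (κ + 1) ^ (2 * T)) ?_
  filter_upwards [hc] with k hk
  obtain ⟨C, hT, hO, hC⟩ := hprep k
  rw [Real.norm_natCast, Real.norm_natCast] at hk
  rw [Real.norm_natCast, Real.norm_of_nonneg (qfi_nonneg _ _)]
  exact qfi_le_mul_of_depth_le (H k) hk hT hO hC

end Bounds

end ShallowQFI

end

theorem theorem1 :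
    -- the bound through the lightcone growth function of an arbitrary connectivity constraint
    (∀ (n m K t : ℕ) (𝒢 : Connectivity n) (H : LocalHamiltonian n m K) (ρ : QState n)
        (C : Circuit n), C.depth = t → C.Obeys 𝒢 → C.Prepares ρ →
        qfi ρ H.total ≤ (m : ℝ) * (K : ℝ) ^ 2 * (growth 𝒢 (2 * t) : ℝ)) ∧
    -- all-to-all connectivity: the bound with `κ ^ (2t)`
    (∀ (n m K κ t : ℕ) (H : LocalHamiltonian n m K) (ρ : QState n)
        (C : Circuit n), C.depth = t → C.Obeys (allToAll n κ) → C.Prepares ρ →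
        qfi ρ H.total ≤ (m : ℝ) * (K : ℝ) ^ 2 * (κ : ℝ) ^ (2 * t)) ∧
    -- `r` dimensions: the bound with `(2(κ-1)(2t)+1)^r`
    (∀ (n m K κ t r : ℕ) (pos : Fin n → Fin r → ℤ) (H : LocalHamiltonian n m K) (ρ : QState n)
        (C : Circuit n), 1 ≤ κ → Function.Injective pos →
        C.depth = t → C.Obeys (lattice pos κ) → C.Prepares ρ →
        qfi ρ H.total ≤
          (m : ℝ) * (K : ℝ) ^ 2 * (2 * ((κ : ℝ) - 1) * (2 * (t : ℝ)) + 1) ^ r) ∧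
    -- `r` dimensions: the growth function is at most `(2(κ-1)t+1)^r`, and equal to it as soon as
    -- some site is surrounded by a sufficiently large full box of sites
    (∀ (n κ t r : ℕ) (pos : Fin n → Fin r → ℤ), 1 ≤ κ → Function.Injective pos →
        (growth (lattice pos κ) t : ℝ) ≤ (2 * ((κ : ℝ) - 1) * (t : ℝ) + 1) ^ r ∧
        ((∃ q : Fin n, ∀ v : Fin r → ℤ,
            (∀ i, |v i - pos q i| ≤ ((κ : ℤ) - 1) * (t : ℤ)) → ∃ q', pos q' = v) →
          (growth (lattice pos κ) t : ℝ) = (2 * ((κ : ℝ) - 1) * (t : ℝ) + 1) ^ r)) ∧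
    -- shallow circuits: the quantum Fisher information is `O(n)`, with a uniform constant
    (∀ (K κ T : ℕ) (c : ℝ), ∃ c' : ℝ, ∀ (n m : ℕ) (H : LocalHamiltonian n m K) (ρ : QState n)
        (C : Circuit n), (m : ℝ) ≤ c * (n : ℝ) →
        C.depth ≤ T → C.Obeys (allToAll n κ) → C.Prepares ρ →
        qfi ρ H.total ≤ c' * (n : ℝ)) ∧
    -- beating this scaling requires long-range entanglement
    (∀ (K : ℕ) (n m : ℕ → ℕ) (H : ∀ k, LocalHamiltonian (n k) (m k) K) (ρ : ∀ k, QState (n k)),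
        ((fun k => (m k : ℝ)) =O[atTop] fun k => (n k : ℝ)) →
        (¬ (fun k => qfi (ρ k) (H k).total) =O[atTop] fun k => (n k : ℝ)) →
        IsLongRangeEntangled ρ) := by
  have hlattice (κ t r : ℕ) :
      (((2 * (κ * t) + 1) ^ r : ℕ) : ℝ) = (2 * (((κ + 1 : ℕ) : ℝ) - 1) * t + 1) ^ r := by
    push_cast
    ring
  refine ⟨?_, ?_, ?_, ?_, ?_, ?_⟩
  · rintro n m K t 𝒢 H ρ C rfl hO hC
    exact qfi_le_growth H hO hC
  · rintro n m K κ t H ρ C rfl hO hC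
    exact qfi_le_allToAll H hO hC
  · rintro n m K (_ | k) t r pos H ρ C hκ hpos rfl hO hC
    · exact absurd hκ (by norm_num)
    · refine (qfi_le_growth H hO hC).trans (mul_le_mul_of_nonneg_left ?_ (by positivity))
      exact_mod_cast (Nat.cast_le.2 (growth_lattice_le hpos k _)).trans_eq (hlattice k _ r)
  · rintro n (_ | k) t r pos hκ hpos
    · exact absurd hκ (by norm_num)
    · rw [← hlattice]
      refine ⟨Nat.cast_le.2 (growth_lattice_le hpos k t), fun ⟨q, hq⟩ => ?_⟩
      refine congrArg Nat.cast (growth_lattice_eq (q := q) hpos fun v hv => hq v ?_)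
      simpa [mem_latticeBox] using hv
  · exact fun K κ T c => ⟨c * K ^ 2 * (κ + 1) ^ (2 * T), fun n m H ρ C hm hT hO hC =>
      qfi_le_mul_of_depth_le H hm hT hO hC⟩
  · exact fun K n m H ρ hm hF hρ => hF (hρ.isBigO_qfi H hm)
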